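/- Let $k\ge 2$ and $V=\{1,\dots,k\}$, and let $V^{(2)}=\{\{i,j\}:1\le i<j\le k\}$. For a simple graph $G=(V,E)$, $E\subseteq V^{(2)}$, let $i_m(G)$ be the number of independent sets of $m$ vertices of $G$, and put $$A_G=\prod_p\left(\sum_{m=0}^k\frac{i_m(G)}{p^m}\left(1-\frac1p\right)^{k-m}\right),$$ a convergent product over all primes $p$. For positive integers $n_1,\dots,n_k$ let $\beta_r(n_1,\dots,n_k)$, respectively $\beta'_r(n_1,\dots,n_k)$, be $1$ if exactly $r$, respectively at least $r$, of the pairs $(n_i,n_j)$ with $1\le i<j\le k$ are coprime, and $0$ otherwise. Then, as $x\to\infty$, for every integer $r\ge 0$, $$\sum_{n_1,\dots,n_k\le x}\beta_r(n_1,\dots,n_k)=C_{k,r}\,x^k+O\big(x^{k-1}(\log x)^{k-1}\big),$$ and for every integer $r\ge 1$, $$\sum_{n_1,\dots,n_k\le x}\beta'_r(n_1,\dots,n_k)=C'_{k,r}\,x^k+O\big(x^{k-1}(\log x)^{k-1}\big),$$ where $$C_{k,r}=\sum_{j=r}^{k(k-1)/2}(-1)^{j-r}\binom jr\sum_{\substack{E\subseteq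 V^{(2)}\\|E|=j}}A_{(V,E)},\qquad C'_{k,r}=\sum_{j=r}^{k(k-1)/2}(-1)^{j-r}\binom{j-1}{r-1}\sum_{\substack{E\subseteq V^{(2)}\\|E|=j}}A_{(V,E)}.$$ Moreover, $C_{k,r}$ ($r\ge0$) and $C'_{k,r}$ ($r\ge1$) are the asymptotic densities of the $k$-tuples of positive integers with exactly $r$, respectively at least $r$, coprime pairs, that is, the mean values $$\lim_{x_1,\dots,x_k\to\infty}\frac1{x_1\cdots x_k}\sum_{n_1\le x_1,\dots,n_k\le x_k}\beta_r(n_1,\dots,n_k)=C_{k,r}$$ and, likewise with $\beta'_r$ in place of $\beta_r$, $C'_{k,r}$, where $x_1,\dots,x_k$ tend to infinity independently. -/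

import Mathlib

open Filter Topology Asymptotics

/-- `i_m(G)`: the number of independent sets of `m` vertices of the graph `G`. -/
noncomputable def numIndepSets {k : ℕ} (G : SimpleGraph (Fin k)) (m : ℕ) : ℕ :=
  open Classical in (G.indepSetFinset m).card

/-- The factor at `p` of the Euler product `A_G`. -/
noncomputable def eulerFactor {k : ℕ} (G : SimpleGraph (Fin k)) (p : ℕ) : ℝ :=
  ∑ m ∈ Finset.range (k + 1),
    (numIndepSets G m : ℝ) / (p : ℝ) ^ m * (1 - 1 / (p : ℝ)) ^ (k - m)

/-- `A_G`, an infinite product over all primes. -/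
noncomputable def graphDensity {k : ℕ} (G : SimpleGraph (Fin k)) : ℝ :=
  ∏' p : Nat.Primes, eulerFactor G p

/-- `V^(2)`: the set of all unordered pairs of distinct elements of the vertex set. -/
def allPairs (k : ℕ) : Finset (Sym2 (Fin k)) :=
  (⊤ : SimpleGraph (Fin k)).edgeFinset

/-- The sum of `A_G` over all graphs `G = (V, E)` with exactly `j` edges. -/
noncomputable def graphDensitySum (k j : ℕ) : ℝ :=
  ∑ E ∈ (allPairs k).powersetCard j,
    graphDensity (SimpleGraph.fromEdgeSet (E : Set (Sym2 (Fin k))))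

/-- The constant `C_{k,r}`. -/
noncomputable def exactConst (k r : ℕ) : ℝ :=
  ∑ j ∈ Finset.Icc r (k * (k - 1) / 2),
    (-1 : ℝ) ^ (j - r) * (j.choose r : ℝ) * graphDensitySum k j

/-- The constant `C'_{k,r}` (for `r ≥ 1`). -/
noncomputable def atLeastConst (k r : ℕ) : ℝ :=
  ∑ j ∈ Finset.Icc r (k * (k - 1) / 2),
    (-1 : ℝ) ^ (j - r) * ((j - 1).choose (r - 1) : ℝ) * graphDensitySum k j

/-- The number of index pairs `i < j` such that `n_i` and `n_j` are coprime. -/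
def numCoprimePairs {k : ℕ} (n : Fin k → ℕ) : ℕ :=
  (Finset.univ.filter
    (fun e : Fin k × Fin k => e.1 < e.2 ∧ Nat.Coprime (n e.1) (n e.2))).card

/-- `β_r`: the indicator function of exactly `r` pairs being coprime. -/
def betaExact {k : ℕ} (r : ℕ) (n : Fin k → ℕ) : ℝ :=
  if numCoprimePairs n = r then 1 else 0

/-- `β'_r`: the indicator function of at least `r` pairs being coprime. -/
def betaAtLeast {k : ℕ} (r : ℕ) (n : Fin k → ℕ) : ℝ :=
  if r ≤ numCoprimePairs n then 1 else 0

/-- The tuples of positive integers with `n_i ≤ x_i` for all `i`. -/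
noncomputable def tupleBox {k : ℕ} (x : Fin k → ℝ) : Finset (Fin k → ℕ) :=
  Fintype.piFinset (fun i => Finset.Icc 1 ⌊x i⌋₊)

/-- `f` has mean value `M`: the average of `f` over the box `n_i ≤ x_i` tends to `M` as
`x_1, …, x_k` tend to infinity independently. For an indicator function of a set of tuples,
`M` is the asymptotic density of the set. -/
def HasMeanValue {k : ℕ} (f : (Fin k → ℕ) → ℝ) (M : ℝ) : Prop :=
  Tendsto (fun x : Fin k → ℝ => (∑ n ∈ tupleBox x, f n) / ∏ i, x i) atTop (𝓝 M)

/-! Exactly `t` coprime pairs means that `t.choose j` edge sets of size `j` lie inside the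
coprimality graph of the tuple. Binomial inversion thus writes both indicators as combinations of
`coprimeIndicator G`, and it suffices to count the tuples coprime along the edges of one graph `G`.

Such a tuple is one where, for every prime `p`, the vertices `i` with `p ∣ n i` form an independent
set. This local indicator is a multi-affine polynomial in the divisibility indicators, with
coefficients `sieveCoeff`; setting every variable to `1 / p` gives `eulerFactor G p`. Multiplying
over `p ≤ y`, expanding and summing over a box gives products of floors `⌊X i / d i⌋`. Dropping the
floors costs one omitted factor `X i / d i`, and the resulting error refolds into an Euler product
(`abs_sum_sievedIndicator_sub_le`). Singletons have coefficient `0` and pairs at most `1` in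
absolute value, so its factors are at most `1 + (k - 1) / p + O(1 / p ^ 2)`
(`sum_abs_sieveCoeff_mul_pow_le`), and Mertens' bound makes it `O((log y) ^ (k - 1))`.

Primes above `y`, in the count and in the Euler product, contribute a relative error `O(1 / y)`.
Taking `y = ⌊x⌋` gives the error term on cubes; keeping `y` fixed while the sides grow gives the
mean value. -/

/-! ### Mertens' upper bounds for sums over primes -/

theorem prime_pow_dvd_factorial {p : ℕ} (hp : 0 < p) (m : ℕ) : p ^ m ∣ (p * m).factorial := by
  induction m with
  | zero => simp
  | succ m ih =>
    rw [pow_succ, mul_add, mul_one]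
    exact (mul_dvd_mul ih (Nat.dvd_factorial hp le_rfl)).trans
      (Nat.factorial_mul_factorial_dvd_factorial_add _ _)

theorem prod_primesLE_pow_dvd_factorial (N : ℕ) :
    ∏ p ∈ N.primesLE, p ^ (N / p) ∣ N.factorial := by
  refine Finset.prod_dvd_of_isRelPrime ?_ ?_
  · intro p hp q hq hpq
    rw [Function.onFun, ← Nat.coprime_iff_isRelPrime]
    exact Nat.Coprime.pow _ _ ((Nat.coprime_primes (Nat.prime_of_mem_primesLE hp)
      (Nat.prime_of_mem_primesLE hq)).2 hpq)
  · intro p hp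
    exact (prime_pow_dvd_factorial (Nat.prime_of_mem_primesLE hp).pos _).trans
      (Nat.factorial_dvd_factorial (Nat.mul_div_le N p))

/-- The upper bound in Mertens' first theorem. -/
theorem sum_log_div_primesLE_le {N : ℕ} (hN : 1 ≤ N) :
    ∑ p ∈ N.primesLE, Real.log p / p ≤ Real.log N + Real.log 4 := by
  have hN' : (0 : ℝ) < N := by exact_mod_cast hN
  have h1 : ∑ p ∈ N.primesLE, ((N / p : ℕ) : ℝ) * Real.log p ≤ N * Real.log N := by
    have h : ∏ p ∈ N.primesLE, p ^ (N / p) ≤ N ^ N :=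
      (Nat.le_of_dvd N.factorial_pos (prod_primesLE_pow_dvd_factorial N)).trans
        (Nat.factorial_le_pow N)
    have hpos : ∀ p ∈ N.primesLE, ((p : ℝ) ^ (N / p)) ≠ 0 := fun p hp =>
      pow_ne_zero _ (by exact_mod_cast (Nat.prime_of_mem_primesLE hp).ne_zero)
    have h' : (∏ p ∈ N.primesLE, (p : ℝ) ^ (N / p)) ≤ (N : ℝ) ^ N := by exact_mod_cast h
    have := Real.log_le_log (Finset.prod_pos fun p hp =>
      pow_pos (by exact_mod_cast (Nat.prime_of_mem_primesLE hp).pos) _) h'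
    rw [Real.log_prod hpos, Real.log_pow] at this
    simpa only [Real.log_pow] using this
  -- Replacing `N / p` by its floor loses at most `log p` per prime, in total `θ(N) ≤ N log 4`.
  have h2 : N * ∑ p ∈ N.primesLE, Real.log p / p
      ≤ ∑ p ∈ N.primesLE, ((N / p : ℕ) : ℝ) * Real.log p + ∑ p ∈ N.primesLE, Real.log p := by
    rw [Finset.mul_sum, ← Finset.sum_add_distrib]
    refine Finset.sum_le_sum fun p hp => ?_
    have hp' := Nat.prime_of_mem_primesLE hp
    have hl : 0 ≤ Real.log p := Real.log_nonneg (by exact_mod_cast hp'.one_le)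
    have hf : (N : ℝ) / p ≤ ((N / p : ℕ) : ℝ) + 1 := by
      rw [← Nat.floor_div_eq_div (K := ℝ)]
      exact (Nat.lt_floor_add_one _).le
    calc (N : ℝ) * (Real.log p / p) = (N / p) * Real.log p := by ring
      _ ≤ (((N / p : ℕ) : ℝ) + 1) * Real.log p := by gcongr
      _ = _ := by ring
  have h3 : ∑ p ∈ N.primesLE, Real.log p ≤ Real.log 4 * N := by
    rw [← Chebyshev.theta_eq_sum_primesLE_log]
    exact Chebyshev.theta_le_log4_mul_x hN'.le
  refine le_of_mul_le_mul_left ?_ hN'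
  linarith

/-- Summation by parts between `∑ 1 / p` and `∑ log p / p`. -/
theorem sum_inv_primesLE_sub_le {N : ℕ} (hN : 2 ≤ N) :
    ∑ p ∈ N.primesLE, 1 / (p : ℝ) - (∑ p ∈ N.primesLE, Real.log p / p) / Real.log N ≤
      Real.log (Real.log N) - Real.log (Real.log 2) +
        Real.log 4 * (1 / Real.log 2 - 1 / Real.log N) := by
  induction N, hN using Nat.le_induction with
  | base =>
    have h2 : Nat.primesLE 2 = {2} := by decide
    have : Real.log 2 ≠ 0 := (Real.log_pos one_lt_two).ne'
    simp [h2]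
    field_simp
    simp
  | succ N hN ih =>
    set A := ∑ p ∈ N.primesLE, Real.log p / p with hA
    set T := ∑ p ∈ N.primesLE, 1 / (p : ℝ) with hT
    set u := Real.log N with hu
    set v := Real.log ((N + 1 : ℕ) : ℝ) with hv
    have hu0 : 0 < u := Real.log_pos (by exact_mod_cast hN)
    have huv : u ≤ v := Real.log_le_log (by positivity) (by push_cast; linarith)
    have hv0 : 0 < v := hu0.trans_le huv
    -- A new prime `p = N + 1` cancels here, because `1 / p = (log p / p) / v`; only the change of
    -- the divisor from `u` to `v` matters.
    have hstep : ∑ p ∈ (N + 1).primesLE, 1 / (p : ℝ)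
        - (∑ p ∈ (N + 1).primesLE, Real.log p / p) / v = T - A / v := by
      rw [Nat.primesLE_succ]
      split_ifs with h
      · rw [Finset.sum_insert (Nat.notMem_primesLE N), Finset.sum_insert (Nat.notMem_primesLE N),
          ← hA, ← hT, ← hv]
        have : ((N + 1 : ℕ) : ℝ) ≠ 0 := by positivity
        field_simp
        ring
      · rfl
    rw [hstep]
    have hAle : A ≤ u + Real.log 4 := sum_log_div_primesLE_le (by lia)
    have hd : 0 ≤ 1 / u - 1 / v := sub_nonneg.2 (one_div_le_one_div_of_le hu0 huv)
    -- The main part of the increment, `1 - u / v ≤ log (v / u)`, telescopes to `log log N`.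
    have hlog : u * (1 / u - 1 / v) ≤ Real.log v - Real.log u := by
      have := Real.one_sub_inv_le_log_of_pos (div_pos hv0 hu0)
      rw [Real.log_div hv0.ne' hu0.ne', inv_div] at this
      calc u * (1 / u - 1 / v) = 1 - u / v := by field_simp
        _ ≤ _ := this
    have := mul_le_mul_of_nonneg_right hAle hd
    have e : T - A / v = (T - A / u) + A * (1 / u - 1 / v) := by ring
    rw [e]
    nlinarith

/-- The upper bound in Mertens' second theorem. -/
theorem exists_sum_inv_primesLE_le :
    ∃ C : ℝ, ∀ N : ℕ, 2 ≤ N →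
      ∑ p ∈ N.primesLE, 1 / (p : ℝ) ≤ Real.log (Real.log N) + C := by
  refine ⟨1 - Real.log (Real.log 2) + Real.log 4 * (1 / Real.log 2), fun N hN => ?_⟩
  have hl : 0 < Real.log N := Real.log_pos (by exact_mod_cast hN)
  have h1 := sum_inv_primesLE_sub_le hN
  have h2 : (∑ p ∈ N.primesLE, Real.log p / p) / Real.log N ≤ 1 + Real.log 4 * (1 / Real.log N) := by
    rw [div_le_iff₀ hl]
    have := sum_log_div_primesLE_le (N := N) (by lia)
    field_simp
    linarith
  linarith

/-- Products over the primes up to `N` of factors at most `1 + m / p + c / p ^ 2` grow at most like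
`(log N) ^ m`. -/
theorem exists_prod_primesLE_le (m : ℕ) (c : ℝ) (hc : 0 ≤ c) :
    ∃ C : ℝ, 0 ≤ C ∧ ∀ (N : ℕ) (f : ℕ → ℝ), 2 ≤ N → (∀ p ∈ N.primesLE, 0 ≤ f p) →
      (∀ p ∈ N.primesLE, f p ≤ 1 + m * (1 / (p : ℝ)) + c * (1 / (p : ℝ)) ^ 2) →
      ∏ p ∈ N.primesLE, f p ≤ C * Real.log N ^ m := by
  obtain ⟨C, hC⟩ := exists_sum_inv_primesLE_le
  refine ⟨Real.exp (m * C + c * 2), (Real.exp_pos _).le, fun N f hN h0 hf => ?_⟩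
  have hl : 0 < Real.log N := Real.log_pos (by exact_mod_cast hN)
  have hsq : ∑ p ∈ N.primesLE, (1 / (p : ℝ)) ^ 2 ≤ 2 := by
    have h := sum_Ioo_inv_sq_le (α := ℝ) 0 (N + 1)
    have hsub : N.primesLE ⊆ Finset.Ioo 0 (N + 1) := fun p hp => by
      rw [Finset.mem_Ioo]
      have := (Nat.prime_of_mem_primesLE hp).pos
      have := Nat.le_of_mem_primesLE hp
      lia
    refine le_trans ?_ (h.trans (by norm_num))
    simp only [one_div, inv_pow]
    exact Finset.sum_le_sum_of_subset_of_nonneg hsub fun _ _ _ => by positivity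
  calc ∏ p ∈ N.primesLE, f p
      ≤ ∏ p ∈ N.primesLE, Real.exp (m * (1 / (p : ℝ)) + c * (1 / (p : ℝ)) ^ 2) := by
        refine Finset.prod_le_prod h0 fun p hp => (hf p hp).trans ?_
        have := Real.add_one_le_exp (m * (1 / (p : ℝ)) + c * (1 / (p : ℝ)) ^ 2)
        linarith
    _ = Real.exp (m * ∑ p ∈ N.primesLE, 1 / (p : ℝ) + c * ∑ p ∈ N.primesLE, (1 / (p : ℝ)) ^ 2) := by
        rw [← Real.exp_sum, Finset.sum_add_distrib, Finset.mul_sum, Finset.mul_sum]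
    _ ≤ Real.exp (m * (Real.log (Real.log N) + C) + c * 2) := by
        have := hC N hN
        gcongr
    _ = Real.exp (m * C + c * 2) * Real.log N ^ m := by
        rw [show (m : ℝ) * (Real.log (Real.log N) + C) + c * 2
          = (m * C + c * 2) + m * Real.log (Real.log N) by ring, Real.exp_add, Real.exp_nat_mul,
          Real.exp_log hl]

/-! ### The coprimality graph and binomial inversion -/

/-- The indicator function of the tuples with coprime entries along every edge of `G`. -/
noncomputable def coprimeIndicator {k : ℕ} (G : SimpleGraph (Fin k)) (n : Fin k → ℕ) : ℝ :=
  open Classical in if ∀ i j, G.Adj i j → Nat.Coprime (n i) (n j) then 1 else 0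

/-- The edge set of the coprimality graph of the tuple `n`. -/
noncomputable def coprimeEdges {k : ℕ} (n : Fin k → ℕ) : Finset (Sym2 (Fin k)) :=
  open Classical in
  Finset.image (fun e : Fin k × Fin k => s(e.1, e.2)) (Finset.univ.filter
    (fun e : Fin k × Fin k => e.1 < e.2 ∧ Nat.Coprime (n e.1) (n e.2)))

theorem mk_mem_coprimeEdges {k : ℕ} {n : Fin k → ℕ} {i j : Fin k} :
    s(i, j) ∈ coprimeEdges n ↔ i ≠ j ∧ Nat.Coprime (n i) (n j) := by
  simp only [coprimeEdges, Finset.mem_image, Finset.mem_filter, Finset.mem_univ, true_and,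
    Prod.exists, Sym2.eq_iff]
  constructor
  · rintro ⟨a, b, ⟨hab, hc⟩, ⟨rfl, rfl⟩ | ⟨rfl, rfl⟩⟩
    · exact ⟨hab.ne, hc⟩
    · exact ⟨hab.ne', hc.symm⟩
  · rintro ⟨hne, hc⟩
    rcases lt_or_gt_of_ne hne with h | h
    · exact ⟨i, j, ⟨h, hc⟩, Or.inl ⟨rfl, rfl⟩⟩
    · exact ⟨j, i, ⟨h, hc.symm⟩, Or.inr ⟨rfl, rfl⟩⟩

theorem card_coprimeEdges {k : ℕ} (n : Fin k → ℕ) :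
    (coprimeEdges n).card = numCoprimePairs n := by
  classical
  unfold coprimeEdges numCoprimePairs
  refine Finset.card_image_of_injOn ?_
  rintro ⟨a, b⟩ h1 ⟨c, d⟩ h2 h
  simp only [Finset.coe_filter, Finset.mem_univ, true_and, Set.mem_ofPred_eq] at h1 h2
  simp only [Sym2.eq_iff] at h
  rcases h with ⟨rfl, rfl⟩ | ⟨rfl, rfl⟩
  · rfl
  · exact absurd h1.1 (not_lt.2 h2.1.le)

theorem coprimeEdges_subset {k : ℕ} (n : Fin k → ℕ) : coprimeEdges n ⊆ allPairs k := by
  intro e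
  induction e with
  | _ i j =>
    intro h
    simpa [allPairs] using (mk_mem_coprimeEdges.1 h).1

theorem card_allPairs (k : ℕ) : (allPairs k).card = k * (k - 1) / 2 := by
  rw [allPairs, SimpleGraph.card_edgeFinset_top_eq_card_choose_two, Fintype.card_fin,
    Nat.choose_two_right]

theorem numCoprimePairs_le {k : ℕ} (n : Fin k → ℕ) : numCoprimePairs n ≤ k * (k - 1) / 2 := by
  rw [← card_coprimeEdges, ← card_allPairs]
  exact Finset.card_le_card (coprimeEdges_subset n)

theorem coprimeIndicator_fromEdgeSet {k : ℕ} {E : Finset (Sym2 (Fin k))} (hE : E ⊆ allPairs k)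
    (n : Fin k → ℕ) [Decidable (E ⊆ coprimeEdges n)] :
    coprimeIndicator (SimpleGraph.fromEdgeSet (E : Set (Sym2 (Fin k)))) n
      = if E ⊆ coprimeEdges n then 1 else 0 := by
  have key : (∀ i j, (SimpleGraph.fromEdgeSet (E : Set (Sym2 (Fin k)))).Adj i j →
      Nat.Coprime (n i) (n j)) ↔ E ⊆ coprimeEdges n := by
    constructor
    · intro h e
      induction e with
      | _ i j =>
        intro he
        have hne : i ≠ j := by simpa [allPairs] using hE he
        exact mk_mem_coprimeEdges.2 ⟨hne, h i j (by simpa using ⟨he, hne⟩)⟩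
    · intro h i j hij
      have : s(i, j) ∈ E ∧ i ≠ j := by simpa using hij
      exact (mk_mem_coprimeEdges.1 (h this.1)).2
  unfold coprimeIndicator
  by_cases h : E ⊆ coprimeEdges n
  · rw [if_pos h, if_pos (key.2 h)]
  · rw [if_neg h, if_neg (key.not.2 h)]

/-- A summand is `1` exactly when `E` is contained in the coprimality graph, so the sum counts the
`j`-subsets of its edge set. -/
theorem sum_coprimeIndicator_powersetCard {k : ℕ} (n : Fin k → ℕ) (j : ℕ) :
    ∑ E ∈ (allPairs k).powersetCard j,
      coprimeIndicator (SimpleGraph.fromEdgeSet (E : Set (Sym2 (Fin k)))) n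
      = ((numCoprimePairs n).choose j : ℝ) := by
  classical
  rw [← card_coprimeEdges, ← Finset.card_powersetCard, Finset.cast_card,
    Finset.sum_congr rfl fun E hE =>
      coprimeIndicator_fromEdgeSet (Finset.mem_powersetCard.1 hE).1 n, ← Finset.sum_filter]
  refine Finset.sum_congr ?_ fun _ _ => rfl
  ext E
  simp only [Finset.mem_filter, Finset.mem_powersetCard]
  exact ⟨fun h => ⟨h.2, h.1.2⟩, fun h => ⟨⟨h.1.trans (coprimeEdges_subset n), h.2⟩, h.1⟩⟩

/-- By `C(t, j) C(j, r) = C(t, r) C(t - r, j - r)` this is `C(t, r)` times an alternating row sum of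
Pascal's triangle; terms with `j > t` vanish. -/
theorem sum_Icc_alternating_choose_mul_choose {t M : ℕ} (ht : t ≤ M) (r : ℕ) :
    ∑ j ∈ Finset.Icc r M, (-1 : ℝ) ^ (j - r) * (j.choose r : ℝ) * (t.choose j : ℝ)
      = if t = r then 1 else 0 := by
  rcases lt_or_ge t r with htr | htr
  · rw [if_neg htr.ne]
    refine Finset.sum_eq_zero fun j hj => ?_
    rw [Nat.choose_eq_zero_of_lt (htr.trans_le (Finset.mem_Icc.1 hj).1)]
    simp
  · obtain ⟨s, rfl⟩ := Nat.exists_eq_add_of_le htr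
    have h1 : ∑ j ∈ Finset.Icc r M, (-1 : ℝ) ^ (j - r) * (j.choose r : ℝ) * ((r + s).choose j : ℝ)
        = ∑ j ∈ Finset.Ico r (r + s + 1),
          (-1 : ℝ) ^ (j - r) * (j.choose r : ℝ) * ((r + s).choose j : ℝ) := by
      symm
      refine Finset.sum_subset ?_ ?_
      · intro j hj
        simp only [Finset.mem_Ico, Finset.mem_Icc] at *
        lia
      · intro j hj hj'
        simp only [Finset.mem_Ico, Finset.mem_Icc] at *
        rw [Nat.choose_eq_zero_of_lt (show r + s < j by lia)]
        simp
    have h2 : ∀ i ∈ Finset.range (s + 1),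
        (-1 : ℝ) ^ (r + i - r) * ((r + i).choose r : ℝ) * ((r + s).choose (r + i) : ℝ)
        = ((r + s).choose r : ℝ) * (((-1 : ℤ) ^ i * (s.choose i : ℤ) : ℤ) : ℝ) := by
      intro i hi
      have := Nat.choose_mul (n := r + s) (k := r + i) (s := r) (by lia)
      rw [Nat.add_sub_cancel_left, Nat.add_sub_cancel_left] at this
      have h' : ((r + s).choose (r + i) : ℝ) * ((r + i).choose r : ℝ)
        = ((r + s).choose r : ℝ) * (s.choose i : ℝ) := by exact_mod_cast this
      rw [Nat.add_sub_cancel_left]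
      push_cast
      linear_combination (-1 : ℝ) ^ i * h'
    rw [h1, Finset.sum_Ico_eq_sum_range, show r + s + 1 - r = s + 1 by lia,
      Finset.sum_congr rfl h2, ← Finset.mul_sum, ← Int.cast_sum, Int.alternating_sum_range_choose]
    rcases Nat.eq_zero_or_pos s with rfl | hs
    · simp
    · rw [if_neg hs.ne', if_neg (by lia)]
      simp

/-- Induction on `t`: Pascal's rule for `C(t + 1, j)` adds to the sum for `t` the "exactly `r - 1`"
sum, which is `1` just when `t = r - 1`. -/
theorem sum_Icc_alternating_choose_pred_mul_choose {t M : ℕ} (ht : t ≤ M) {r : ℕ} (hr : 1 ≤ r) :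
    ∑ j ∈ Finset.Icc r M, (-1 : ℝ) ^ (j - r) * ((j - 1).choose (r - 1) : ℝ) * (t.choose j : ℝ)
      = if r ≤ t then 1 else 0 := by
  obtain ⟨r, rfl⟩ := Nat.exists_eq_add_of_le' hr
  induction t with
  | zero =>
    rw [if_neg (by lia)]
    refine Finset.sum_eq_zero fun j hj => ?_
    rw [Nat.choose_eq_zero_of_lt (show 0 < j by have := (Finset.mem_Icc.1 hj).1; lia)]
    simp
  | succ t ih =>
    obtain ⟨M, rfl⟩ := Nat.exists_eq_add_of_le' (show 1 ≤ M by lia)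
    have h1 := ih (by lia)
    have h2 := sum_Icc_alternating_choose_mul_choose (t := t) (M := M) (by lia) r
    have e : Finset.Icc (r + 1) (M + 1) = (Finset.Icc r M).map (addRightEmbedding 1) := by
      simp
    rw [e, Finset.sum_map] at h1 ⊢
    simp only [addRightEmbedding_apply, Nat.add_sub_add_right, Nat.add_sub_cancel,
      Nat.choose_succ_succ, Nat.cast_add, mul_add, Finset.sum_add_distrib] at h1 ⊢
    rw [h1, h2]
    by_cases h : t = r
    · subst h; simp
    · rw [if_neg h]
      by_cases h' : r + 1 ≤ t
      · rw [if_pos h', if_pos (by lia), zero_add]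
      · rw [if_neg h', if_neg (by lia), zero_add]

theorem betaExact_eq_sum {k : ℕ} (r : ℕ) (n : Fin k → ℕ) :
    betaExact r n = ∑ j ∈ Finset.Icc r (k * (k - 1) / 2),
      (-1 : ℝ) ^ (j - r) * (j.choose r : ℝ) * ∑ E ∈ (allPairs k).powersetCard j,
        coprimeIndicator (SimpleGraph.fromEdgeSet (E : Set (Sym2 (Fin k)))) n := by
  simp only [sum_coprimeIndicator_powersetCard]
  rw [sum_Icc_alternating_choose_mul_choose (numCoprimePairs_le n), betaExact]

theorem betaAtLeast_eq_sum {k : ℕ} {r : ℕ} (hr : 1 ≤ r) (n : Fin k → ℕ) :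
    betaAtLeast r n = ∑ j ∈ Finset.Icc r (k * (k - 1) / 2),
      (-1 : ℝ) ^ (j - r) * ((j - 1).choose (r - 1) : ℝ) * ∑ E ∈ (allPairs k).powersetCard j,
        coprimeIndicator (SimpleGraph.fromEdgeSet (E : Set (Sym2 (Fin k)))) n := by
  simp only [sum_coprimeIndicator_powersetCard]
  rw [sum_Icc_alternating_choose_pred_mul_choose (numCoprimePairs_le n) hr, betaAtLeast]

/-! ### The local polynomial at a prime -/

/-- The coefficients of the multi-affine polynomial that takes the value `1` at the indicator
function of an independent set and `0` at every other indicator function. -/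
noncomputable def sieveCoeff {k : ℕ} (G : SimpleGraph (Fin k)) (S : Finset (Fin k)) : ℝ :=
  open Classical in
  ∑ U ∈ S.powerset, if G.IsIndepSet (U : Set (Fin k)) then (-1) ^ (S \ U).card else 0

section

variable {k : ℕ} (G : SimpleGraph (Fin k))

open Classical in
-- Expand `∏ (1 - y i)` over the complement of `U` and collect the monomials `S = U ∪ W`. The right
-- side is easy to evaluate both at `0`-`1` points and at the constant point `1 / p`.
theorem sum_sieveCoeff_mul_prod (y : Fin k → ℝ) :
    ∑ S, sieveCoeff G S * ∏ i ∈ S, y i =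
      ∑ U : Finset (Fin k), if G.IsIndepSet (U : Set (Fin k)) then
        (∏ i ∈ U, y i) * ∏ i ∈ Uᶜ, (1 - y i) else 0 := by
  simp only [sieveCoeff, Finset.sum_mul]
  rw [Finset.sum_comm' (t' := Finset.univ) (s' := fun U => Finset.univ.filter (U ⊆ ·))
    (by simp)]
  refine Finset.sum_congr rfl fun U _ => ?_
  split_ifs with hU
  · have h : ∏ i ∈ Uᶜ, (1 - y i) = ∑ W ∈ Uᶜ.powerset, (-1) ^ W.card * ∏ i ∈ W, y i := by
      simp only [sub_eq_add_neg, Finset.prod_one_add, Finset.prod_neg]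
    rw [h, Finset.mul_sum]
    refine Finset.sum_nbij' (fun S => S \ U) (fun W => U ∪ W) ?_ ?_ ?_ ?_ ?_
    · intro S _
      rw [Finset.mem_powerset]
      intro x hx
      simp at hx
      simp [hx.2]
    · intro W _
      simp
    · intro S hS
      exact Finset.union_sdiff_of_subset (Finset.mem_filter.1 hS).2
    · intro W hW
      rw [Finset.mem_powerset] at hW
      exact Finset.union_sdiff_cancel_left
        (Finset.disjoint_left.2 fun x hx hx' => Finset.mem_compl.1 (hW hx') hx)
    · intro S hS
      rw [← Finset.prod_sdiff (Finset.mem_filter.1 hS).2]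
      ring
  · simp

open Classical in
theorem sum_sieveCoeff_mul_indicator (T : Finset (Fin k)) :
    ∑ S, sieveCoeff G S * ∏ i ∈ S, (if i ∈ T then (1 : ℝ) else 0) =
      if G.IsIndepSet (T : Set (Fin k)) then 1 else 0 := by
  rw [sum_sieveCoeff_mul_prod, Finset.sum_eq_single T]
  · have h1 : ∏ i ∈ T, (if i ∈ T then (1 : ℝ) else 0) = 1 :=
      Finset.prod_eq_one fun i hi => if_pos hi
    have h2 : ∏ i ∈ Tᶜ, (1 - if i ∈ T then (1 : ℝ) else 0) = 1 :=
      Finset.prod_eq_one fun i hi => by rw [if_neg (Finset.mem_compl.1 hi), sub_zero]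
    rw [h1, h2, mul_one]
  · intro U _ hUT
    split_ifs with hU
    · by_cases hsub : U ⊆ T
      · obtain ⟨i, hiT, hiU⟩ := Finset.exists_of_ssubset (hsub.ssubset_of_ne hUT)
        rw [Finset.prod_eq_zero (Finset.mem_compl.2 hiU) (by rw [if_pos hiT, sub_self]), mul_zero]
      · obtain ⟨i, hiU, hiT⟩ := Finset.not_subset.1 hsub
        rw [Finset.prod_eq_zero hiU (if_neg hiT), zero_mul]
    · rfl
  · simp

open Classical in
theorem eulerFactor_eq_sum_indepSet (p : ℕ) :
    eulerFactor G p = ∑ U : Finset (Fin k), if G.IsIndepSet (U : Set (Fin k)) then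
        (1 / (p : ℝ)) ^ U.card * (1 - 1 / (p : ℝ)) ^ Uᶜ.card else 0 := by
  rw [← Finset.sum_filter, ← Finset.sum_fiberwise_of_maps_to (g := Finset.card)
    (t := Finset.range (k + 1))]
  · refine Finset.sum_congr rfl fun m _ => ?_
    have h : numIndepSets G m = ((Finset.univ.filter fun U : Finset (Fin k) =>
        G.IsIndepSet (U : Set (Fin k))).filter fun U => U.card = m).card := by
      unfold numIndepSets
      congr 1
      ext U
      simp [SimpleGraph.isNIndepSet_iff]
    rw [Finset.sum_congr rfl fun U hU => ?_, Finset.sum_const, nsmul_eq_mul, ← h]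
    rotate_left
    · exact ((1 / (p : ℝ)) ^ m * (1 - 1 / (p : ℝ)) ^ (k - m))
    · rw [Finset.card_compl, Fintype.card_fin, (Finset.mem_filter.1 hU).2]
    · ring
  · intro U _
    have := Finset.card_le_univ U
    simp at this ⊢
    lia

theorem eulerFactor_eq_sum_sieveCoeff (p : ℕ) :
    eulerFactor G p = ∑ S, sieveCoeff G S * (1 / (p : ℝ)) ^ S.card := by
  have := sum_sieveCoeff_mul_prod G (fun _ => 1 / (p : ℝ))
  simp only [Finset.prod_const] at this
  rw [this, eulerFactor_eq_sum_indepSet]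

theorem one_sub_one_div_nonneg (p : ℕ) : 0 ≤ 1 - 1 / (p : ℝ) := by
  rcases Nat.eq_zero_or_pos p with rfl | hp
  · simp
  · have : (1 : ℝ) ≤ p := by exact_mod_cast hp
    rw [sub_nonneg, div_le_one (by linarith)]
    exact this

theorem eulerFactor_nonneg (p : ℕ) : 0 ≤ eulerFactor G p := by
  classical
  rw [eulerFactor_eq_sum_indepSet]
  have := one_sub_one_div_nonneg p
  refine Finset.sum_nonneg fun U _ => ?_
  split_ifs <;> positivity

/-- Without the independence condition the sum over `U` is `(1 / p + (1 - 1 / p)) ^ k = 1`. -/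
theorem eulerFactor_le_one (p : ℕ) : eulerFactor G p ≤ 1 := by
  classical
  rw [eulerFactor_eq_sum_indepSet]
  have h0 := one_sub_one_div_nonneg p
  have h := Fintype.prod_add (fun _ : Fin k => 1 / (p : ℝ)) (fun _ => 1 - 1 / (p : ℝ))
  simp only [add_sub_cancel, Finset.prod_const_one, Finset.prod_const] at h
  refine le_of_le_of_eq (Finset.sum_le_sum fun U _ => ?_) h.symm
  split_ifs
  · rfl
  · positivity

open Classical in
-- The Möbius-inverted form of the definition, from which the coefficients of small sets can be read
-- off.
theorem sum_powerset_sieveCoeff (T : Finset (Fin k)) :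
    ∑ S ∈ T.powerset, sieveCoeff G S = if G.IsIndepSet (T : Set (Fin k)) then 1 else 0 := by
  rw [← sum_sieveCoeff_mul_indicator]
  simp only [Finset.prod_boole, mul_ite, mul_one, mul_zero]
  rw [← Finset.sum_filter]
  refine Finset.sum_congr ?_ fun _ _ => rfl
  ext S
  simp [Finset.subset_iff]

theorem sieveCoeff_empty : sieveCoeff G ∅ = 1 := by
  classical
  have h := sum_powerset_sieveCoeff G ∅
  rw [if_pos (by simp [SimpleGraph.isIndepSet_iff])] at h
  simpa using h

/-- A single vertex is always independent. The missing linear term makes the Euler product converge.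
-/
theorem sieveCoeff_singleton (i : Fin k) : sieveCoeff G {i} = 0 := by
  classical
  have h := sum_powerset_sieveCoeff G {i}
  rw [if_pos (by simp [SimpleGraph.isIndepSet_iff]), ← insert_empty_eq i,
    Finset.sum_powerset_insert (by simp)] at h
  simpa [sieveCoeff_empty] using h

theorem abs_sieveCoeff_pair_le {i j : Fin k} (h : i ≠ j) : |sieveCoeff G {i, j}| ≤ 1 := by
  classical
  have h2 := sum_powerset_sieveCoeff G {i, j}
  rw [Finset.sum_powerset_insert (by simpa using h), ← insert_empty_eq j,
    Finset.sum_powerset_insert (by simp), Finset.sum_powerset_insert (by simp)] at h2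
  simp only [Finset.powerset_empty, Finset.sum_singleton, insert_empty_eq, sieveCoeff_empty,
    sieveCoeff_singleton] at h2
  split_ifs at h2 <;> rw [abs_le] <;> constructor <;> linarith

theorem abs_sieveCoeff_le (S : Finset (Fin k)) : |sieveCoeff G S| ≤ 2 ^ k := by
  classical
  unfold sieveCoeff
  refine (Finset.abs_sum_le_sum_abs _ _).trans ?_
  calc _ ≤ ∑ U ∈ S.powerset, (1 : ℝ) := by
        refine Finset.sum_le_sum fun U _ => ?_
        split_ifs <;> simp
    _ = 2 ^ S.card := by simp
    _ ≤ 2 ^ k := by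
        have := Finset.card_le_univ S
        rw [Fintype.card_fin] at this
        exact pow_le_pow_right₀ (by norm_num) this

theorem sum_finset_two_pow (c : ℝ) : ∑ _S : Finset (Fin k), 2 ^ k * c = 4 ^ k * c := by
  simp only [Finset.sum_const, Finset.card_univ, Fintype.card_finset, Fintype.card_fin,
    nsmul_eq_mul]
  push_cast
  rw [← mul_assoc, ← mul_pow]
  norm_num

/-- Only sets with at least two elements contribute; there are at most `2 ^ k` of them, with
coefficients at most `2 ^ k`. -/
theorem abs_eulerFactor_sub_one_le {p : ℕ} (hp : 1 ≤ p) :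
    |eulerFactor G p - 1| ≤ 4 ^ k * (1 / (p : ℝ)) ^ 2 := by
  have hp' : (1 : ℝ) ≤ p := by exact_mod_cast hp
  have ht0 : 0 ≤ 1 / (p : ℝ) := by positivity
  have ht1 : 1 / (p : ℝ) ≤ 1 := by rw [div_le_one (by linarith)]; exact hp'
  have h1 : (1 : ℝ) = ∑ S : Finset (Fin k), if S = ∅ then 1 else 0 := by simp
  rw [eulerFactor_eq_sum_sieveCoeff, ← sum_finset_two_pow]
  nth_rewrite 2 [h1]
  rw [← Finset.sum_sub_distrib]
  refine (Finset.abs_sum_le_sum_abs _ _).trans (Finset.sum_le_sum fun S _ => ?_)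
  rcases Nat.lt_or_ge S.card 2 with hS | hS
  · interval_cases hc : S.card
    · obtain rfl := Finset.card_eq_zero.1 hc
      simp only [sieveCoeff_empty, pow_zero, if_true, mul_one, sub_self, abs_zero]
      positivity
    · obtain ⟨i, rfl⟩ := Finset.card_eq_one.1 hc
      simp only [sieveCoeff_singleton, Finset.singleton_ne_empty, if_false, zero_mul, sub_self,
        abs_zero]
      positivity
  · rw [if_neg (by rintro rfl; simp at hS), sub_zero, abs_mul, abs_of_nonneg (pow_nonneg ht0 _)]
    exact mul_le_mul (abs_sieveCoeff_le G S) (pow_le_pow_of_le_one ht0 ht1 hS) (by positivity)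
      (by positivity)

/-- Source of the exponent `k - 1` of the logarithm: singletons vanish, so order `t` comes only from
the `k - 1` pairs `{i, j}`, each with coefficient at most `1` in absolute value. -/
theorem sum_abs_sieveCoeff_mul_pow_le (i : Fin k) {t : ℝ} (ht0 : 0 ≤ t) (ht1 : t ≤ 1) :
    ∑ S, |sieveCoeff G S| * t ^ (S.erase i).card ≤ 1 + (k - 1 : ℕ) * t + 4 ^ k * t ^ 2 := by
  classical
  set D : Finset (Finset (Fin k)) := (Finset.univ.erase i).image fun j => {i, j} with hD
  have hDc : (D.card : ℝ) ≤ (k - 1 : ℕ) := by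
    have : D.card ≤ k - 1 := Finset.card_image_le.trans (by simp)
    exact_mod_cast this
  have key : ∀ S : Finset (Fin k), |sieveCoeff G S| * t ^ (S.erase i).card ≤
      (if S = ∅ then 1 else 0) + (if S ∈ D then t else 0) + 2 ^ k * t ^ 2 := by
    intro S
    have n1 : (0 : ℝ) ≤ if S ∈ D then t else 0 := by split_ifs <;> simp [ht0]
    have n0 : (0 : ℝ) ≤ if S = ∅ then 1 else 0 := by split_ifs <;> simp
    have n2 : 0 ≤ 2 ^ k * t ^ 2 := by positivity
    rcases Nat.lt_or_ge (S.erase i).card 2 with hS | hS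
    · interval_cases hc : (S.erase i).card
      · have hsub : S ⊆ {i} := by
          rw [Finset.card_eq_zero, Finset.erase_eq_empty_iff] at hc
          rcases hc with rfl | rfl <;> simp
        rcases Finset.subset_singleton_iff.1 hsub with rfl | rfl
        · rw [sieveCoeff_empty]
          simp only [if_true, abs_one, pow_zero, mul_one]
          linarith
        · rw [sieveCoeff_singleton]
          simp only [abs_zero, zero_mul]
          positivity
      · obtain ⟨j, hj⟩ := Finset.card_eq_one.1 hc
        have hji : j ≠ i := Finset.ne_of_mem_erase (s := S) (by rw [hj]; simp)
        by_cases hi : i ∈ S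
        · have hS' : S = {i, j} := by rw [← Finset.insert_erase hi, hj]
          have hmem : S ∈ D := by
            rw [hD, Finset.mem_image]
            exact ⟨j, by simp [hji], hS'.symm⟩
          rw [if_pos hmem, pow_one]
          have : |sieveCoeff G S| ≤ 1 := by rw [hS']; exact abs_sieveCoeff_pair_le G hji.symm
          have := mul_le_mul_of_nonneg_right this ht0
          linarith
        · rw [Finset.erase_eq_of_notMem hi] at hj
          rw [hj, sieveCoeff_singleton, abs_zero, zero_mul, ← hj]
          positivity
    · have := mul_le_mul (abs_sieveCoeff_le G S) (pow_le_pow_of_le_one ht0 ht1 hS) (by positivity)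
        (by positivity)
      linarith
  refine (Finset.sum_le_sum fun S _ => key S).trans ?_
  rw [Finset.sum_add_distrib, Finset.sum_add_distrib, sum_finset_two_pow]
  have h2 : ∑ S : Finset (Fin k), (if S ∈ D then t else 0) = D.card * t := by
    rw [Finset.sum_ite_mem, Finset.univ_inter, Finset.sum_const, nsmul_eq_mul]
  have h1 : ∑ S : Finset (Fin k), (if S = ∅ then (1 : ℝ) else 0) = 1 := by simp
  rw [h1, h2]
  gcongr

end

/-! ### Counting sieved tuples in a box -/

/-- The difference of two products is controlled by the sum of the products with one factor
omitted. -/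
theorem Finset.abs_prod_sub_prod_le {ι : Type*} [DecidableEq ι] (s : Finset ι) {u v : ι → ℝ}
    (h0 : ∀ i ∈ s, 0 ≤ u i) (h1 : ∀ i ∈ s, u i ≤ v i) (h2 : ∀ i ∈ s, v i ≤ u i + 1) :
    |∏ i ∈ s, u i - ∏ i ∈ s, v i| ≤ ∑ i ∈ s, ∏ j ∈ s.erase i, v j := by
  induction s using Finset.induction_on with
  | empty => simp
  | insert a s ha ih =>
    have h0' : ∀ i ∈ s, 0 ≤ u i := fun i hi => h0 i (Finset.mem_insert_of_mem hi)
    have h1' : ∀ i ∈ s, u i ≤ v i := fun i hi => h1 i (Finset.mem_insert_of_mem hi)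
    have ih' := ih h0' h1' (fun i hi => h2 i (Finset.mem_insert_of_mem hi))
    have ha0 := h0 a (Finset.mem_insert_self a s)
    have ha1 := h1 a (Finset.mem_insert_self a s)
    have ha2 := h2 a (Finset.mem_insert_self a s)
    have hu : 0 ≤ ∏ i ∈ s, u i := Finset.prod_nonneg h0'
    have huv : ∏ i ∈ s, u i ≤ ∏ i ∈ s, v i := Finset.prod_le_prod h0' h1'
    rw [Finset.prod_insert ha, Finset.prod_insert ha, Finset.sum_insert ha,
      Finset.erase_insert ha]
    have h3 : ∀ i ∈ s, ∏ j ∈ (insert a s).erase i, v j = v a * ∏ j ∈ s.erase i, v j := by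
      intro i hi
      rw [Finset.erase_insert_of_ne (by rintro rfl; exact ha hi),
        Finset.prod_insert fun h => ha (Finset.mem_of_mem_erase h)]
    rw [Finset.sum_congr rfl h3, ← Finset.mul_sum,
      show u a * ∏ i ∈ s, u i - v a * ∏ i ∈ s, v i
        = (u a - v a) * ∏ i ∈ s, u i + v a * (∏ i ∈ s, u i - ∏ i ∈ s, v i) by ring]
    refine (abs_add_le _ _).trans (add_le_add ?_ ?_)
    · rw [abs_mul, abs_of_nonneg hu]
      have : |u a - v a| ≤ 1 := by rw [abs_le]; constructor <;> linarith
      nlinarith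
    · rw [abs_mul, abs_of_nonneg (ha0.trans ha1)]
      exact mul_le_mul_of_nonneg_left ih' (ha0.trans ha1)

theorem sum_Icc_dvd_indicator (N d : ℕ) :
    ∑ m ∈ Finset.Icc 1 N, (if d ∣ m then (1 : ℝ) else 0) = (N / d : ℕ) := by
  rw [← Nat.Ioc_filter_dvd_card_eq_div, Finset.sum_boole]
  rfl

section

variable {k : ℕ}

theorem sum_tupleBox_prod (X : Fin k → ℝ) (w : Fin k → ℕ → ℝ) :
    ∑ n ∈ tupleBox X, ∏ i, w i (n i) = ∏ i, ∑ m ∈ Finset.Icc 1 ⌊X i⌋₊, w i m :=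
  (Finset.prod_univ_sum _ _).symm

/-- The product of the primes `p ∈ P` with `i ∈ f p`. -/
def vertexModulus {P : Finset ℕ} (f : P → Finset (Fin k)) (i : Fin k) : ℕ :=
  ∏ a : P, if i ∈ f a then (a : ℕ) else 1

theorem vertexModulus_dvd_iff {P : Finset ℕ} (hP : ∀ p ∈ P, p.Prime) (f : P → Finset (Fin k))
    (i : Fin k) (m : ℕ) : vertexModulus f i ∣ m ↔ ∀ a : P, i ∈ f a → (a : ℕ) ∣ m := by
  unfold vertexModulus
  constructor
  · intro h a ha
    refine dvd_trans ?_ h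
    have := Finset.dvd_prod_of_mem (fun a : P => if i ∈ f a then (a : ℕ) else 1)
      (Finset.mem_univ a)
    simpa only [if_pos ha] using this
  · intro h
    refine Finset.prod_dvd_of_isRelPrime ?_ ?_
    · intro a _ b _ hab
      rw [Function.onFun, ← Nat.coprime_iff_isRelPrime]
      split_ifs
      · exact (Nat.coprime_primes (hP a a.2) (hP b b.2)).2 fun h => hab (Subtype.ext h)
      all_goals simp
    · intro a _
      split_ifs with ha
      · exact h a ha
      · exact one_dvd m

theorem prod_prod_dvd_indicator {P : Finset ℕ} (hP : ∀ p ∈ P, p.Prime)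
    (f : P → Finset (Fin k)) (n : Fin k → ℕ) :
    ∏ a : P, ∏ i ∈ f a, (if (a : ℕ) ∣ n i then (1 : ℝ) else 0)
      = ∏ i, if vertexModulus f i ∣ n i then (1 : ℝ) else 0 := by
  rw [Finset.prod_boole]
  split_ifs with h
  · refine Finset.prod_eq_one fun a _ => Finset.prod_eq_one fun i hi => if_pos ?_
    exact (vertexModulus_dvd_iff hP f i (n i)).1 (h i (Finset.mem_univ i)) a hi
  · simp only [Finset.mem_univ, true_implies, vertexModulus_dvd_iff hP] at h
    push Not at h
    obtain ⟨i, a, hi, ha⟩ := h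
    exact Finset.prod_eq_zero (Finset.mem_univ a) (Finset.prod_eq_zero hi (if_neg ha))

theorem prod_one_div_vertexModulus {P : Finset ℕ} (f : P → Finset (Fin k)) (s : Finset (Fin k)) :
    ∏ i ∈ s, 1 / (vertexModulus f i : ℝ) = ∏ a : P, (1 / ((a : ℕ) : ℝ)) ^ (s ∩ f a).card := by
  have h : ∀ i, 1 / (vertexModulus f i : ℝ)
      = ∏ a : P, if i ∈ f a then 1 / ((a : ℕ) : ℝ) else 1 := by
    intro i
    rw [vertexModulus, Nat.cast_prod, one_div, ← Finset.prod_inv_distrib]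
    refine Finset.prod_congr rfl fun a _ => ?_
    split_ifs <;> simp
  simp only [h]
  rw [Finset.prod_comm]
  refine Finset.prod_congr rfl fun a _ => ?_
  rw [Finset.prod_ite_mem, Finset.prod_const]

/-- The indicator function of the tuples `n` for which no prime of `P` divides both ends of an
edge of `G`, as a product of polynomial expressions in the divisibility indicators. -/
noncomputable def sievedIndicator (G : SimpleGraph (Fin k)) (P : Finset ℕ) (n : Fin k → ℕ) : ℝ :=
  ∏ p ∈ P, ∑ S, sieveCoeff G S * ∏ i ∈ S, if p ∣ n i then 1 else 0

open Classical in
theorem sievedIndicator_eq_ite (G : SimpleGraph (Fin k)) (P : Finset ℕ) (n : Fin k → ℕ) :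
    sievedIndicator G P n =
      if ∀ p ∈ P, ∀ i j, G.Adj i j → p ∣ n i → ¬ p ∣ n j then 1 else 0 := by
  have h : ∀ p, ∑ S, sieveCoeff G S * ∏ i ∈ S, (if p ∣ n i then (1 : ℝ) else 0)
      = if ∀ i j, G.Adj i j → p ∣ n i → ¬ p ∣ n j then 1 else 0 := by
    intro p
    have := sum_sieveCoeff_mul_indicator G (Finset.univ.filter fun i => p ∣ n i)
    simp only [Finset.mem_filter, Finset.mem_univ, true_and] at this
    rw [this]
    refine if_congr ?_ rfl rfl
    rw [SimpleGraph.isIndepSet_iff]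
    constructor
    · intro h i j hij hi hj
      exact h (by simpa using hi) (by simpa using hj) hij.ne hij
    · intro h i hi j hj _ hij
      exact h i j hij (by simpa using hi) (by simpa using hj)
  rw [sievedIndicator, Finset.prod_congr rfl fun p _ => h p, Finset.prod_boole]

theorem sievedIndicator_eq_sum (G : SimpleGraph (Fin k)) {P : Finset ℕ}
    (hP : ∀ p ∈ P, p.Prime) (n : Fin k → ℕ) :
    sievedIndicator G P n = ∑ f : P → Finset (Fin k), (∏ a, sieveCoeff G (f a)) *
      ∏ i, if vertexModulus f i ∣ n i then (1 : ℝ) else 0 := by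
  rw [sievedIndicator, ← Finset.prod_coe_sort, Fintype.prod_sum]
  refine Finset.sum_congr rfl fun f _ => ?_
  rw [Finset.prod_mul_distrib, prod_prod_dvd_indicator hP]

theorem sum_sievedIndicator (G : SimpleGraph (Fin k)) {P : Finset ℕ}
    (hP : ∀ p ∈ P, p.Prime) (X : Fin k → ℝ) :
    ∑ n ∈ tupleBox X, sievedIndicator G P n = ∑ f : P → Finset (Fin k),
      (∏ a, sieveCoeff G (f a)) * ∏ i, ((⌊X i⌋₊ / vertexModulus f i : ℕ) : ℝ) := by
  simp only [sievedIndicator_eq_sum G hP]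
  rw [Finset.sum_comm]
  refine Finset.sum_congr rfl fun f _ => ?_
  rw [← Finset.mul_sum, sum_tupleBox_prod X fun i m => if vertexModulus f i ∣ m then (1 : ℝ) else 0]
  simp only [sum_Icc_dvd_indicator]

theorem prod_eulerFactor_eq_sum (G : SimpleGraph (Fin k)) (P : Finset ℕ) :
    ∏ p ∈ P, eulerFactor G p = ∑ f : P → Finset (Fin k),
      (∏ a, sieveCoeff G (f a)) * ∏ i, 1 / (vertexModulus f i : ℝ) := by
  rw [← Finset.prod_coe_sort]
  simp only [eulerFactor_eq_sum_sieveCoeff]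
  rw [Fintype.prod_sum]
  refine Finset.sum_congr rfl fun f _ => ?_
  rw [Finset.prod_mul_distrib, prod_one_div_vertexModulus]
  simp

/-- Each floor is within `1` of its argument, so a product of floors changes by at most the products
with one factor omitted. Summed with absolute values over all `f`, these factor again over the
primes, so no truncation of the expansion is needed. -/
theorem abs_sum_sievedIndicator_sub_le (G : SimpleGraph (Fin k)) {P : Finset ℕ}
    (hP : ∀ p ∈ P, p.Prime) {X : Fin k → ℝ} (hX : ∀ i, 0 ≤ X i) :
    |∑ n ∈ tupleBox X, sievedIndicator G P n - (∏ i, X i) * ∏ p ∈ P, eulerFactor G p| ≤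
      ∑ i, (∏ j ∈ Finset.univ.erase i, X j) *
        ∏ p ∈ P, ∑ S, |sieveCoeff G S| * (1 / (p : ℝ)) ^ (S.erase i).card := by
  have hB : ∀ i, ∏ p ∈ P, ∑ S, |sieveCoeff G S| * (1 / (p : ℝ)) ^ (S.erase i).card
      = ∑ f : P → Finset (Fin k), |∏ a, sieveCoeff G (f a)| *
        ∏ j ∈ Finset.univ.erase i, 1 / (vertexModulus f j : ℝ) := by
    intro i
    rw [← Finset.prod_coe_sort, Fintype.prod_sum]
    refine Finset.sum_congr rfl fun f _ => ?_
    rw [Finset.prod_mul_distrib, prod_one_div_vertexModulus, Finset.abs_prod]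
    congr 1
    refine Finset.prod_congr rfl fun a _ => ?_
    rw [Finset.erase_inter, Finset.univ_inter]
  simp only [hB]
  rw [sum_sievedIndicator G hP, prod_eulerFactor_eq_sum, Finset.mul_sum, ← Finset.sum_sub_distrib]
  simp only [Finset.mul_sum]
  rw [Finset.sum_comm]
  refine (Finset.abs_sum_le_sum_abs _ _).trans (Finset.sum_le_sum fun f _ => ?_)
  have e1 : (∏ i, X i) * ((∏ a, sieveCoeff G (f a)) * ∏ i, 1 / (vertexModulus f i : ℝ))
      = (∏ a, sieveCoeff G (f a)) * ∏ i, X i / (vertexModulus f i : ℝ) := by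
    simp only [div_eq_mul_one_div (X _) _, Finset.prod_mul_distrib]
    ring
  have e2 : ∀ i, (∏ j ∈ Finset.univ.erase i, X j) * (|∏ a, sieveCoeff G (f a)| *
      ∏ j ∈ Finset.univ.erase i, 1 / (vertexModulus f j : ℝ))
      = |∏ a, sieveCoeff G (f a)| * ∏ j ∈ Finset.univ.erase i, X j / (vertexModulus f j : ℝ) := by
    intro i
    simp only [div_eq_mul_one_div (X _) _, Finset.prod_mul_distrib]
    ring
  simp only [e2]
  rw [e1, ← mul_sub, abs_mul, ← Finset.mul_sum]
  refine mul_le_mul_of_nonneg_left (Finset.abs_prod_sub_prod_le _ (fun i _ => by positivity) ?_ ?_)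
    (abs_nonneg _)
  · intro i _
    rw [← Nat.floor_div_natCast]
    exact Nat.floor_le (div_nonneg (hX i) (by positivity))
  · intro i _
    rw [← Nat.floor_div_natCast]
    exact (Nat.lt_floor_add_one _).le

/-! ### Common primes above the sieving level -/

theorem coprimeIndicator_le_sievedIndicator (G : SimpleGraph (Fin k)) {P : Finset ℕ}
    (hP : ∀ p ∈ P, p.Prime) (n : Fin k → ℕ) : coprimeIndicator G n ≤ sievedIndicator G P n := by
  classical
  rw [sievedIndicator_eq_ite, coprimeIndicator]
  split_ifs with h1 h2 h2
  · rfl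
  · exact absurd (fun p hp i j hij hi hj => Nat.not_coprime_of_dvd_of_dvd (hP p hp).one_lt hi hj
      (h1 i j hij)) h2
  · exact zero_le_one
  · rfl

/-- If the indicators differ, two adjacent entries share a prime above `y`. The bound counts all
integers `m > y` in place of primes; `Z` only keeps the sum finite. -/
theorem sievedIndicator_sub_coprimeIndicator_le (G : SimpleGraph (Fin k)) {y Z : ℕ}
    {n : Fin k → ℕ} (hn : ∀ i, 0 < n i) (hZ : ∀ i, n i < Z) :
    sievedIndicator G y.primesLE n - coprimeIndicator G n ≤
      ∑ e ∈ (Finset.univ : Finset (Fin k)).offDiag, ∑ m ∈ Finset.Ioo y Z,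
        if m ∣ n e.1 ∧ m ∣ n e.2 then (1 : ℝ) else 0 := by
  classical
  have hnn : ∀ (e : Fin k × Fin k) (m : ℕ), (0 : ℝ) ≤ if m ∣ n e.1 ∧ m ∣ n e.2 then 1 else 0 :=
    fun e m => by split_ifs <;> norm_num
  have hnonneg : (0 : ℝ) ≤ ∑ e ∈ (Finset.univ : Finset (Fin k)).offDiag, ∑ m ∈ Finset.Ioo y Z,
      if m ∣ n e.1 ∧ m ∣ n e.2 then (1 : ℝ) else 0 :=
    Finset.sum_nonneg fun e _ => Finset.sum_nonneg fun m _ => hnn e m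
  rw [sievedIndicator_eq_ite, coprimeIndicator]
  split_ifs with h1 h2 h2
  · simpa using hnonneg
  · push Not at h2
    obtain ⟨i, j, hij, hc⟩ := h2
    obtain ⟨p, hp, hpi, hpj⟩ := Nat.Prime.not_coprime_iff_dvd.1 hc
    have hpm : p ∈ Finset.Ioo y Z := by
      rw [Finset.mem_Ioo]
      refine ⟨?_, (Nat.le_of_dvd (hn i) hpi).trans_lt (hZ i)⟩
      by_contra hle
      exact h1 p (Nat.mem_primesLE.2 ⟨not_lt.1 hle, hp⟩) i j hij hpi hpj
    rw [sub_zero]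
    calc (1 : ℝ) = if p ∣ n i ∧ p ∣ n j then 1 else 0 := by rw [if_pos ⟨hpi, hpj⟩]
      _ ≤ ∑ m ∈ Finset.Ioo y Z, if m ∣ n i ∧ m ∣ n j then (1 : ℝ) else 0 :=
        Finset.single_le_sum (f := fun m => if m ∣ n i ∧ m ∣ n j then (1 : ℝ) else 0)
          (fun m _ => hnn (i, j) m) hpm
      _ ≤ _ := Finset.single_le_sum (f := fun e : Fin k × Fin k => ∑ m ∈ Finset.Ioo y Z,
          if m ∣ n e.1 ∧ m ∣ n e.2 then (1 : ℝ) else 0) (a := (i, j))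
          (fun e _ => Finset.sum_nonneg fun m _ => hnn e m) (by simpa using hij.ne)
  · linarith
  · simpa using hnonneg

theorem sum_tupleBox_dvd_pair_le {X : Fin k → ℝ} (hX : ∀ i, 0 ≤ X i) {i j : Fin k} (hij : i ≠ j)
    (m : ℕ) : ∑ n ∈ tupleBox X, (if m ∣ n i ∧ m ∣ n j then (1 : ℝ) else 0) ≤
      (∏ l, X l) * ((m : ℝ) ^ 2)⁻¹ := by
  classical
  -- Modulus `m` at `i` and `j` and modulus `1` elsewhere turn the condition into a product over
  -- coordinates.
  set d : Fin k → ℕ := fun l => if l ∈ ({i, j} : Finset (Fin k)) then m else 1 with hd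
  have h1 : ∀ n : Fin k → ℕ, (if m ∣ n i ∧ m ∣ n j then (1 : ℝ) else 0)
      = ∏ l, if d l ∣ n l then (1 : ℝ) else 0 := by
    intro n
    rw [Finset.prod_boole]
    have key : (m ∣ n i ∧ m ∣ n j) ↔ ∀ l ∈ Finset.univ, d l ∣ n l := by
      constructor
      · rintro ⟨hi, hj⟩ l _
        simp only [hd, Finset.mem_insert, Finset.mem_singleton]
        split_ifs with h
        · rcases h with rfl | rfl <;> assumption
        · exact one_dvd _
      · intro h
        have hi := h i (Finset.mem_univ _)
        have hj := h j (Finset.mem_univ _)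
        simp only [hd, Finset.mem_insert, Finset.mem_singleton, true_or, or_true, if_true] at hi hj
        exact ⟨hi, hj⟩
    by_cases h : m ∣ n i ∧ m ∣ n j
    · rw [if_pos h, if_pos (key.1 h)]
    · rw [if_neg h, if_neg (key.not.1 h)]
  have h2 : ∏ l, 1 / (d l : ℝ) = ((m : ℝ) ^ 2)⁻¹ := by
    have : ∀ l, 1 / (d l : ℝ) = if l ∈ ({i, j} : Finset (Fin k)) then 1 / (m : ℝ) else 1 := by
      intro l
      simp only [hd]
      split_ifs <;> simp
    simp only [this]
    rw [Finset.prod_ite_mem, Finset.univ_inter, Finset.prod_const, Finset.card_pair hij, one_div,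
      inv_pow]
  simp only [h1]
  rw [sum_tupleBox_prod X fun l r => if d l ∣ r then (1 : ℝ) else 0, ← h2,
    ← Finset.prod_mul_distrib]
  simp only [sum_Icc_dvd_indicator]
  refine Finset.prod_le_prod (fun _ _ => by positivity) fun l _ => ?_
  rw [← Nat.floor_div_natCast, mul_one_div]
  exact Nat.floor_le (div_nonneg (hX l) (by positivity))

theorem abs_sum_coprimeIndicator_sub_le (G : SimpleGraph (Fin k)) (y : ℕ) {X : Fin k → ℝ}
    (hX : ∀ i, 0 ≤ X i) :
    |∑ n ∈ tupleBox X, coprimeIndicator G n - ∑ n ∈ tupleBox X, sievedIndicator G y.primesLE n| ≤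
      (∏ i, X i) * (k ^ 2 * (2 / (y + 1))) := by
  have hP : ∀ p ∈ y.primesLE, p.Prime := fun p hp => Nat.prime_of_mem_primesLE hp
  have hXp : 0 ≤ ∏ i, X i := Finset.prod_nonneg fun i _ => hX i
  set Z := (Finset.univ.sup fun i => ⌊X i⌋₊) + 1 with hZ
  rw [abs_sub_comm, ← Finset.sum_sub_distrib, abs_of_nonneg (Finset.sum_nonneg fun n _ =>
    sub_nonneg.2 (coprimeIndicator_le_sievedIndicator G hP n))]
  calc _ ≤ ∑ n ∈ tupleBox X, ∑ e ∈ (Finset.univ : Finset (Fin k)).offDiag,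
        ∑ m ∈ Finset.Ioo y Z, if m ∣ n e.1 ∧ m ∣ n e.2 then (1 : ℝ) else 0 := by
        refine Finset.sum_le_sum fun n hn => ?_
        have hn' : ∀ i, 1 ≤ n i ∧ n i ≤ ⌊X i⌋₊ := by simpa [tupleBox] using hn
        refine sievedIndicator_sub_coprimeIndicator_le G (fun i => (hn' i).1) fun i => ?_
        have := Finset.le_sup (f := fun i => ⌊X i⌋₊) (Finset.mem_univ i)
        have := (hn' i).2
        lia
    _ = ∑ e ∈ (Finset.univ : Finset (Fin k)).offDiag, ∑ m ∈ Finset.Ioo y Z,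
        ∑ n ∈ tupleBox X, if m ∣ n e.1 ∧ m ∣ n e.2 then (1 : ℝ) else 0 := by
        rw [Finset.sum_comm]
        exact Finset.sum_congr rfl fun e _ => Finset.sum_comm
    _ ≤ ∑ e ∈ (Finset.univ : Finset (Fin k)).offDiag, (∏ l, X l) * (2 / (y + 1)) := by
        refine Finset.sum_le_sum fun e he => ?_
        refine (Finset.sum_le_sum fun m _ =>
          sum_tupleBox_dvd_pair_le hX (Finset.mem_offDiag.1 he).2.2 m).trans ?_
        rw [← Finset.mul_sum]
        exact mul_le_mul_of_nonneg_left (sum_Ioo_inv_sq_le y Z) hXp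
    _ ≤ _ := by
        rw [Finset.sum_const, nsmul_eq_mul]
        have h1 : (((Finset.univ : Finset (Fin k)).offDiag.card : ℕ) : ℝ) ≤ (k : ℝ) ^ 2 := by
          have : (Finset.univ : Finset (Fin k)).offDiag.card ≤ k ^ 2 := by
            rw [Finset.offDiag_card, Finset.card_univ, Fintype.card_fin, sq]
            exact Nat.sub_le _ _
          exact_mod_cast this
        have : 0 ≤ (∏ l, X l) * (2 / ((y : ℝ) + 1)) := by positivity
        calc _ ≤ (k : ℝ) ^ 2 * ((∏ l, X l) * (2 / ((y : ℝ) + 1))) := by gcongr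
          _ = _ := by ring

end

/-! ### Convergence and tail of the Euler product -/

theorem Finset.one_sub_prod_le_sum {ι : Type*} (s : Finset ι) {a : ι → ℝ}
    (h0 : ∀ i ∈ s, 0 ≤ a i) (h1 : ∀ i ∈ s, a i ≤ 1) :
    1 - ∏ i ∈ s, a i ≤ ∑ i ∈ s, (1 - a i) := by
  classical
  induction s using Finset.induction_on with
  | empty => simp
  | insert b s hb ih =>
    have h0' : ∀ i ∈ s, 0 ≤ a i := fun i hi => h0 i (Finset.mem_insert_of_mem hi)
    have h1' : ∀ i ∈ s, a i ≤ 1 := fun i hi => h1 i (Finset.mem_insert_of_mem hi)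
    have := ih h0' h1'
    have hp : ∏ i ∈ s, a i ≤ 1 := Finset.prod_le_one h0' h1'
    have hb1 := h1 b (Finset.mem_insert_self b s)
    rw [Finset.prod_insert hb, Finset.sum_insert hb]
    nlinarith [mul_nonneg (sub_nonneg.2 hb1) (sub_nonneg.2 hp)]

section

variable {k : ℕ} (G : SimpleGraph (Fin k))

theorem multipliable_eulerFactor : Multipliable fun p : Nat.Primes => eulerFactor G p := by
  have hs : Summable fun p : Nat.Primes => ‖eulerFactor G p - 1‖ := by
    refine Summable.of_nonneg_of_le (fun _ => norm_nonneg _)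
      (fun p => abs_eulerFactor_sub_one_le G p.2.one_le) (Summable.mul_left _ ?_)
    have h : Summable fun n : ℕ => (1 / (n : ℝ)) ^ 2 := by
      simpa only [one_div, inv_pow] using Real.summable_nat_pow_inv.2 one_lt_two
    exact h.comp_injective Nat.Primes.coe_nat_injective
  simpa only [add_sub_cancel] using multipliable_one_add_of_summable hs

theorem tendsto_prod_primesLE_eulerFactor :
    Tendsto (fun N : ℕ => ∏ p ∈ N.primesLE, eulerFactor G p) atTop (𝓝 (graphDensity G)) := by
  have h : Tendsto (fun N : ℕ => N.primesLE.subtype Nat.Prime) atTop atTop := by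
    refine tendsto_atTop_finset_of_monotone (fun M N hMN => ?_) fun p => ⟨p, ?_⟩
    · exact Finset.subtype_mono (Nat.primesLE_mono hMN)
    · simpa [Nat.mem_primesLE] using p.2
  refine ((multipliable_eulerFactor G).hasProd.comp h).congr fun N => ?_
  exact Finset.prod_subtype_of_mem _ fun p hp => Nat.prime_of_mem_primesLE hp

/-- The product up to `N ≥ y` is the one up to `y` times `Q`, with `1 - Q` at most the sum of `4 ^ k
/ p ^ 2` over `p > y`; then `N` tends to infinity. -/
theorem abs_prod_primesLE_eulerFactor_sub_le (y : ℕ) :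
    |∏ p ∈ y.primesLE, eulerFactor G p - graphDensity G| ≤ 4 ^ k * (2 / (y + 1)) := by
  have h0 : ∀ s : Finset ℕ, ∀ p ∈ s, 0 ≤ eulerFactor G p := fun _ p _ => eulerFactor_nonneg G p
  have h1 : ∀ s : Finset ℕ, ∀ p ∈ s, eulerFactor G p ≤ 1 := fun _ p _ => eulerFactor_le_one G p
  refine le_of_tendsto ((tendsto_prod_primesLE_eulerFactor G).const_sub _).abs ?_
  filter_upwards [eventually_ge_atTop y] with N hN
  rw [← Finset.prod_sdiff (Nat.primesLE_mono hN)]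
  set Q := ∏ p ∈ N.primesLE \ y.primesLE, eulerFactor G p
  have hy0 : 0 ≤ ∏ p ∈ y.primesLE, eulerFactor G p := Finset.prod_nonneg (h0 _)
  have hy1 : ∏ p ∈ y.primesLE, eulerFactor G p ≤ 1 := Finset.prod_le_one (h0 _) (h1 _)
  have hQ1 : Q ≤ 1 := Finset.prod_le_one (h0 _) (h1 _)
  have hQ : 1 - Q ≤ 4 ^ k * (2 / (y + 1)) := by
    have hsub : N.primesLE \ y.primesLE ⊆ Finset.Ioo y (N + 1) := by
      intro p hp
      rw [Finset.mem_sdiff, Nat.mem_primesLE, Nat.mem_primesLE] at hp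
      rw [Finset.mem_Ioo]
      exact ⟨by by_contra h; exact hp.2 ⟨not_lt.1 h, hp.1.2⟩, Nat.lt_succ_of_le hp.1.1⟩
    calc 1 - Q ≤ ∑ p ∈ N.primesLE \ y.primesLE, (1 - eulerFactor G p) :=
          Finset.one_sub_prod_le_sum _ (h0 _) (h1 _)
      _ ≤ ∑ p ∈ Finset.Ioo y (N + 1), (1 - eulerFactor G p) :=
          Finset.sum_le_sum_of_subset_of_nonneg hsub fun p _ _ =>
            sub_nonneg.2 (eulerFactor_le_one G p)
      _ ≤ ∑ p ∈ Finset.Ioo y (N + 1), 4 ^ k * ((p : ℝ) ^ 2)⁻¹ := by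
          refine Finset.sum_le_sum fun p hp => ?_
          have hp1 : 1 ≤ p := by have := (Finset.mem_Ioo.1 hp).1; lia
          have := abs_eulerFactor_sub_one_le G hp1
          rw [one_div, inv_pow] at this
          exact (le_abs_self _).trans (by rwa [abs_sub_comm])
      _ ≤ 4 ^ k * (2 / (y + 1)) := by
          rw [← Finset.mul_sum]
          exact mul_le_mul_of_nonneg_left (sum_Ioo_inv_sq_le y (N + 1)) (by positivity)
  rw [abs_le]
  constructor <;> nlinarith

/-! ### Asymptotics for one graph and conclusion -/

/-- The number of tuples in a box that are coprime along the edges of `G`, with an error term that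
is uniform in the box and in the sieving level `y`. -/
theorem exists_abs_sum_coprimeIndicator_sub_le :
    ∃ K C : ℝ, 0 ≤ K ∧ 0 ≤ C ∧ ∀ (y : ℕ) (X : Fin k → ℝ), 2 ≤ y → (∀ i, 0 < X i) →
      |∑ n ∈ tupleBox X, coprimeIndicator G n - graphDensity G * ∏ i, X i| ≤
        (∏ i, X i) * (K / (y + 1) + C * Real.log y ^ (k - 1) * ∑ i, 1 / X i) := by
  obtain ⟨C, hC0, hC⟩ := exists_prod_primesLE_le (k - 1) (4 ^ k) (by positivity)
  -- `2 * k ^ 2` comes from common primes above `y`, and `2 * 4 ^ k` from the tail of the Euler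
  -- product.
  refine ⟨2 * k ^ 2 + 2 * 4 ^ k, C, by positivity, hC0, fun y X hy hX => ?_⟩
  have hX0 : ∀ i, 0 ≤ X i := fun i => (hX i).le
  have hXp : 0 ≤ ∏ i, X i := Finset.prod_nonneg fun i _ => hX0 i
  have hP : ∀ p ∈ y.primesLE, p.Prime := fun p hp => Nat.prime_of_mem_primesLE hp
  have h1 := abs_sum_coprimeIndicator_sub_le G y hX0
  have h2 := abs_sum_sievedIndicator_sub_le G hP hX0
  have h3 := mul_le_mul_of_nonneg_left (abs_prod_primesLE_eulerFactor_sub_le G y) hXp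
  rw [← abs_of_nonneg hXp, ← abs_mul, mul_sub, abs_of_nonneg hXp] at h3
  have h4 : ∑ i, (∏ j ∈ Finset.univ.erase i, X j) *
        ∏ p ∈ y.primesLE, ∑ S, |sieveCoeff G S| * (1 / (p : ℝ)) ^ (S.erase i).card
      ≤ (∏ i, X i) * (C * Real.log y ^ (k - 1) * ∑ i, 1 / X i) := by
    rw [Finset.mul_sum, Finset.mul_sum]
    refine Finset.sum_le_sum fun i _ => ?_
    have hi : ∏ i, X i = X i * ∏ j ∈ Finset.univ.erase i, X j :=
      (Finset.mul_prod_erase _ _ (Finset.mem_univ i)).symm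
    have hb := hC y (fun p => ∑ S, |sieveCoeff G S| * (1 / (p : ℝ)) ^ (S.erase i).card) hy
      (fun p _ => Finset.sum_nonneg fun S _ => by positivity) fun p hp => by
        have hp1 : (1 : ℝ) ≤ p := by exact_mod_cast (hP p hp).one_le
        exact sum_abs_sieveCoeff_mul_pow_le G i (by positivity)
          (by rw [div_le_one (by linarith)]; exact hp1)
    calc _ ≤ (∏ j ∈ Finset.univ.erase i, X j) * (C * Real.log y ^ (k - 1)) :=
          mul_le_mul_of_nonneg_left hb (Finset.prod_nonneg fun j _ => hX0 j)
      _ = _ := by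
          rw [hi]
          have := (hX i).ne'
          field_simp
  calc _ ≤ (∏ i, X i) * (k ^ 2 * (2 / (y + 1))) +
        (∏ i, X i) * (C * Real.log y ^ (k - 1) * ∑ i, 1 / X i) +
        (∏ i, X i) * (4 ^ k * (2 / (y + 1))) := by
        refine le_trans ?_ (add_le_add (add_le_add h1 (h2.trans h4)) h3)
        refine le_trans (le_of_eq ?_) (abs_add_three _ _ _)
        congr 1
        ring
    _ = _ := by ring

theorem isBigO_sum_coprimeIndicator (hk : 1 ≤ k) :
    (fun x : ℝ => (∑ n ∈ tupleBox (fun _ : Fin k => x), coprimeIndicator G n)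
        - graphDensity G * x ^ k)
      =O[atTop] (fun x : ℝ => x ^ (k - 1) * Real.log x ^ (k - 1)) := by
  obtain ⟨K, C, hK, hC, h⟩ := exists_abs_sum_coprimeIndicator_sub_le G
  refine IsBigO.of_bound (K + C * k) ?_
  -- `x ≥ 3` ensures `log x ≥ 1`, so that the term `K x ^ (k - 1)` is absorbed. The level is `y =
  -- ⌊x⌋`, for which `x / (y + 1) ≤ 1`.
  filter_upwards [eventually_ge_atTop 3] with x hx
  have hx0 : 0 < x := by linarith
  have hlog : 1 ≤ Real.log x := by
    rw [Real.le_log_iff_exp_le hx0]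
    linarith [Real.exp_one_lt_d9]
  have hy : 2 ≤ ⌊x⌋₊ := Nat.le_floor (by push_cast; linarith)
  have hyx : (⌊x⌋₊ : ℝ) ≤ x := Nat.floor_le hx0.le
  have hxy : x ≤ (⌊x⌋₊ : ℝ) + 1 := (Nat.lt_floor_add_one x).le
  have hy1 : (1 : ℝ) ≤ ⌊x⌋₊ := by exact_mod_cast (by lia : 1 ≤ ⌊x⌋₊)
  have hL : Real.log ⌊x⌋₊ ^ (k - 1) ≤ Real.log x ^ (k - 1) :=
    pow_le_pow_left₀ (Real.log_nonneg hy1) (Real.log_le_log (by linarith) hyx) _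
  have hL1 : 1 ≤ Real.log x ^ (k - 1) := one_le_pow₀ hlog
  have hb := h ⌊x⌋₊ (fun _ => x) hy fun _ => hx0
  simp only [Finset.prod_const, Finset.sum_const, Finset.card_univ, Fintype.card_fin,
    nsmul_eq_mul] at hb
  rw [Real.norm_eq_abs, Real.norm_of_nonneg (by positivity)]
  refine hb.trans ?_
  have hxk : x ^ k = x ^ (k - 1) * x := by rw [← pow_succ, Nat.sub_add_cancel hk]
  have e1 : x * (K / (⌊x⌋₊ + 1)) ≤ K := by
    rw [mul_div_assoc', div_le_iff₀ (by linarith)]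
    nlinarith
  calc x ^ k * (K / (⌊x⌋₊ + 1) + C * Real.log ⌊x⌋₊ ^ (k - 1) * (k * (1 / x)))
      = x ^ (k - 1) * (x * (K / (⌊x⌋₊ + 1)) + C * k * Real.log ⌊x⌋₊ ^ (k - 1)) := by
        rw [hxk]
        field_simp
    _ ≤ x ^ (k - 1) * (K * Real.log x ^ (k - 1) + C * k * Real.log x ^ (k - 1)) := by
        refine mul_le_mul_of_nonneg_left (add_le_add ?_ ?_) (by positivity)
        · exact e1.trans (le_mul_of_one_le_right hK hL1)
        · exact mul_le_mul_of_nonneg_left hL (by positivity)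
    _ = _ := by ring

theorem tendsto_eval_pi_atTop (i : Fin k) : Tendsto (fun X : Fin k → ℝ => X i) atTop atTop :=
  tendsto_atTop.2 fun b => by
    filter_upwards [eventually_ge_atTop fun _ => b] with X hX using hX i

theorem eventually_forall_pos_pi_atTop : ∀ᶠ X : Fin k → ℝ in atTop, ∀ i, 0 < X i := by
  filter_upwards [eventually_ge_atTop fun _ => 1] with X hX i using zero_lt_one.trans_le (hX i)

/-- The sides may grow at unrelated rates, so `y` is fixed first with `K / (y + 1) < ε`; the other
error term then tends to `0` with the `1 / X i`. -/
theorem hasMeanValue_coprimeIndicator : HasMeanValue (coprimeIndicator G) (graphDensity G) := by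
  obtain ⟨K, C, hK, hC, h⟩ := exists_abs_sum_coprimeIndicator_sub_le G
  rw [HasMeanValue, Metric.tendsto_nhds]
  intro ε hε
  have hlim : Tendsto (fun y : ℕ => K / ((y : ℝ) + 1)) atTop (𝓝 0) :=
    tendsto_const_nhds.div_atTop (tendsto_atTop_add_const_right _ _ tendsto_natCast_atTop_atTop)
  obtain ⟨y, hyK, hy⟩ := ((hlim.eventually_lt_const hε).and (eventually_ge_atTop 2)).exists
  have hlim2 : Tendsto (fun X : Fin k → ℝ =>
      K / ((y : ℝ) + 1) + C * Real.log y ^ (k - 1) * ∑ i, 1 / X i) atTop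
      (𝓝 (K / ((y : ℝ) + 1) + C * Real.log y ^ (k - 1) * ∑ _i : Fin k, 0)) :=
    tendsto_const_nhds.add (tendsto_const_nhds.mul (tendsto_finsetSum _ fun i _ =>
      tendsto_const_nhds.div_atTop (tendsto_eval_pi_atTop i)))
  rw [Finset.sum_const_zero, mul_zero, add_zero] at hlim2
  filter_upwards [hlim2.eventually_lt_const hyK, eventually_forall_pos_pi_atTop] with X hX hpos
  have hP : 0 < ∏ i, X i := Finset.prod_pos fun i _ => hpos i
  rw [Real.dist_eq]
  refine lt_of_le_of_lt ?_ hX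
  rw [div_sub' hP.ne', abs_div, abs_of_pos hP, div_le_iff₀ hP]
  refine le_trans (le_of_eq ?_) ((h y X hy hpos).trans (le_of_eq (mul_comm _ _)))
  rw [mul_comm (graphDensity G)]

end

theorem isBigO_and_hasMeanValue_of_eq_sum {k : ℕ} (hk : 1 ≤ k) (s : Finset ℕ) (w : ℕ → ℝ)
    {f : (Fin k → ℕ) → ℝ}
    (hf : ∀ n, f n = ∑ j ∈ s, w j * ∑ E ∈ (allPairs k).powersetCard j,
      coprimeIndicator (SimpleGraph.fromEdgeSet (E : Set (Sym2 (Fin k)))) n) :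
    ((fun x : ℝ => (∑ n ∈ tupleBox (fun _ : Fin k => x), f n)
        - (∑ j ∈ s, w j * graphDensitySum k j) * x ^ k)
      =O[atTop] (fun x : ℝ => x ^ (k - 1) * Real.log x ^ (k - 1))) ∧
    HasMeanValue f (∑ j ∈ s, w j * graphDensitySum k j) := by
  have hsum : ∀ B : Finset (Fin k → ℕ), ∑ n ∈ B, f n = ∑ j ∈ s, w j *
      ∑ E ∈ (allPairs k).powersetCard j, ∑ n ∈ B,
        coprimeIndicator (SimpleGraph.fromEdgeSet (E : Set (Sym2 (Fin k)))) n := by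
    intro B
    simp only [hf]
    rw [Finset.sum_comm]
    refine Finset.sum_congr rfl fun j _ => ?_
    rw [← Finset.mul_sum, Finset.sum_comm]
  constructor
  · have h := IsBigO.sum (s := s) fun j _ => (IsBigO.sum (s := (allPairs k).powersetCard j)
      fun E _ => isBigO_sum_coprimeIndicator
        (SimpleGraph.fromEdgeSet (E : Set (Sym2 (Fin k)))) hk).const_mul_left (w j)
    refine h.congr_left fun x => ?_
    simp only [hsum, graphDensitySum, Finset.sum_apply, Finset.sum_sub_distrib, mul_sub, Finset.sum_mul, mul_assoc]
  · have h := tendsto_finsetSum s fun j _ => (tendsto_finsetSum ((allPairs k).powersetCard j)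
      fun E _ => hasMeanValue_coprimeIndicator
        (SimpleGraph.fromEdgeSet (E : Set (Sym2 (Fin k))))).const_mul (w j)
    refine h.congr fun X => ?_
    simp only [hsum, Finset.sum_div, mul_div_assoc]

theorem theorem6 (k : ℕ) (hk : 2 ≤ k) :
    (∀ G : SimpleGraph (Fin k),
      Multipliable (fun p : Nat.Primes => eulerFactor G p)) ∧
    (∀ r : ℕ,
      ((fun x : ℝ => (∑ n ∈ tupleBox (fun _ : Fin k => x), betaExact r n)
          - exactConst k r * x ^ k)
        =O[atTop] (fun x : ℝ => x ^ (k - 1) * Real.log x ^ (k - 1))) ∧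
      HasMeanValue (betaExact (k := k) r) (exactConst k r)) ∧
    (∀ r : ℕ, 1 ≤ r →
      ((fun x : ℝ => (∑ n ∈ tupleBox (fun _ : Fin k => x), betaAtLeast r n)
          - atLeastConst k r * x ^ k)
        =O[atTop] (fun x : ℝ => x ^ (k - 1) * Real.log x ^ (k - 1))) ∧
      HasMeanValue (betaAtLeast (k := k) r) (atLeastConst k r)) :=
  ⟨multipliable_eulerFactor,
    fun r => isBigO_and_hasMeanValue_of_eq_sum (by lia) _
      (fun j => (-1 : ℝ) ^ (j - r) * (j.choose r : ℝ)) (betaExact_eq_sum r),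
    fun r hr => isBigO_and_hasMeanValue_of_eq_sum (by lia) _
      (fun j => (-1 : ℝ) ^ (j - r) * ((j - 1).choose (r - 1) : ℝ)) (betaAtLeast_eq_sum hr)⟩
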